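/- Let $\mathcal A$ be a Grothendieck category. A nonzero object $M$ of $\mathcal A$ is \emph{monoform} if for every nonzero subobject $N\subseteq M$, the objects $M$ and $M/N$ have no common nonzero subobject up to isomorphism. Two monoform objects are \emph{atom-equivalent} if they have a common nonzero subobject up to isomorphism, and $\mathrm{ASpec}\,\mathcal A$ is the collection of equivalence classes $\overline H$ (called atoms) of monoform objects $H$. For an object $M$, let $\mathrm{ASupp}\,M$ be the set of atoms $\overline H$ with $H$ a monoform subquotient of $M$. A subset $\Phi\subseteq\mathrm{ASpec}\,\mathcal A$ is open if every $\alpha\in\Phi$ is of the form $\alpha=\overline H$ with $H$ monoform and $\mathrm{ASupp}\,H\subseteq\Phi$; and $\alpha\le\beta$ means that every open subset containing $\alpha$ contains $\beta$. Let $\mathrm{Sp}\,\mathcal A$ be the collection of isomorphism classes of indecomposable injective objects of $\mathcal A$, with the topology that has as a basis of open sets the sets $$\mathrm{Sp}\,\mathcal X=\{I\in\mathrm{Sp}\,\mathcal A \mid \mathrm{Hom}(M,I)\neq 0\text{ for some }M\in\mathcal X\},$$ where $\mathcal X$ runs over the localizing subcategories of $\mathcal A$ (the Serre subcategories $\mathcal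 X$ for which the canonical functor $\mathcal A\to\mathcal A/\mathcal X$ has a right adjoint). For $I,J\in\mathrm{Sp}\,\mathcal A$ put $J\le I$ if $\mathrm{Hom}(M,J)=0$ for every object $M$ with $\mathrm{Hom}(M,I)=0$; this is a preorder. Then every monoform object $H$ has an injective envelope $E(H)$, which is an indecomposable injective object whose isomorphism class depends only on the atom $\alpha=\overline H$ and is denoted by $E(\alpha)$. The map $f:\mathrm{ASpec}\,\mathcal A\to\mathrm{Sp}\,\mathcal A$, $\alpha\mapsto E(\alpha)$, is injective, preorder-preserving and continuous. If $f$ is surjective, then the preorders on $\mathrm{ASpec}\,\mathcal A$ and $\mathrm{Sp}\,\mathcal A$ are partial orders and $f$ is an isomorphism of partially ordered sets. -/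

import Mathlib

universe w v u

open CategoryTheory CategoryTheory.Limits

namespace AtomSpectrum

section Atoms

variable {C : Type u} [Category.{v} C] [Abelian C]

/-- `X` and `Y` have a common nonzero subobject: some nonzero object embeds in both. -/
def HasCommonSubobject (X Y : C) : Prop :=
  ∃ (Z : C) (i : Z ⟶ X) (j : Z ⟶ Y), Mono i ∧ Mono j ∧ ¬ IsZero Z

/-- A nonzero object `M` is monoform if, for every nonzero subobject `N` of `M`, the objects `M`
and `M / N` have no common nonzero subobject. -/
def Monoform (M : C) : Prop :=
  ¬ IsZero M ∧ ∀ (N : C) (i : N ⟶ M), Mono i → ¬ IsZero N → ¬ HasCommonSubobject M (cokernel i)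

/-- `H` is a subquotient of `M`: a quotient of a subobject of `M`. -/
def IsSubquotient (H M : C) : Prop :=
  ∃ (L : C) (i : L ⟶ M) (p : L ⟶ H), Mono i ∧ Epi p

theorem HasCommonSubobject.symm {X Y : C} (h : HasCommonSubobject X Y) :
    HasCommonSubobject Y X := by
  obtain ⟨Z, i, j, hi, hj, hZ⟩ := h
  exact ⟨Z, j, i, hj, hi, hZ⟩

/-- Two nonzero subobjects of a monoform object meet in a nonzero object. -/
theorem Monoform.exists_meet {M : C} (hM : Monoform M) {A B : C} (a : A ⟶ M) (b : B ⟶ M)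
    [Mono a] [Mono b] (hA : ¬ IsZero A) (hB : ¬ IsZero B) :
    ∃ (W : C) (p : W ⟶ A) (q : W ⟶ B), Mono p ∧ Mono q ∧ ¬ IsZero W ∧ p ≫ a = q ≫ b := by
  let k := b ≫ cokernel.π a
  have hk : (kernel.ι k ≫ b) ≫ cokernel.π a = 0 := by
    rw [Category.assoc]; exact kernel.condition k
  refine ⟨kernel k, Abelian.monoLift a (kernel.ι k ≫ b) hk, kernel.ι k, ?_, inferInstance, ?_, ?_⟩
  · have : Mono (Abelian.monoLift a (kernel.ι k ≫ b) hk ≫ a) := by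
      rw [Abelian.monoLift_comp]; infer_instance
    exact mono_of_mono _ a
  · intro h0
    have : Mono k := Preadditive.mono_of_kernel_zero (h0.eq_of_src _ _)
    exact hM.2 A a inferInstance hA ⟨B, b, k, inferInstance, this, hB⟩
  · exact Abelian.monoLift_comp _ _ _

theorem Monoform.hasCommonSubobject_trans {X Y Z : C} (hY : Monoform Y)
    (h₁ : HasCommonSubobject X Y) (h₂ : HasCommonSubobject Y Z) : HasCommonSubobject X Z := by
  obtain ⟨A, i, a, hi, ha, hA⟩ := h₁
  obtain ⟨B, b, j, hb, hj, hB⟩ := h₂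
  obtain ⟨W, p, q, hp, hq, hW, -⟩ := hY.exists_meet a b hA hB
  exact ⟨W, p ≫ i, q ≫ j, mono_comp _ _, mono_comp _ _, hW⟩

/-- A nonzero subobject of a monoform object is monoform. -/
theorem Monoform.of_mono {M Z : C} (hM : Monoform M) (z : Z ⟶ M) [Mono z] (hZ : ¬ IsZero Z) :
    Monoform Z := by
  refine ⟨hZ, fun N i hi hN ⟨A, a, b, ha, hb, hA⟩ => ?_⟩
  refine hM.2 N (i ≫ z) (mono_comp _ _) hN ⟨A, a ≫ z,
    b ≫ cokernel.map i (i ≫ z) (𝟙 N) z (by simp), mono_comp _ _, ?_, hA⟩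
  have : Mono (cokernel.map i (i ≫ z) (𝟙 N) z (by simp)) := by
    refine Preadditive.mono_of_cancel_zero _ fun {T} x hx => ?_
    obtain ⟨T', e, he, y, hy⟩ := surjective_up_to_refinements_of_epi (cokernel.π i) x
    have h : (y ≫ z) ≫ cokernel.π (i ≫ z) = 0 := by
      have h' := congrArg (· ≫ cokernel.map i (i ≫ z) (𝟙 N) z (by simp)) hy
      simpa [hx] using h'.symm
    have hl : Abelian.monoLift (i ≫ z) (y ≫ z) h ≫ i = y := by
      rw [← cancel_mono z, Category.assoc, Abelian.monoLift_comp]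
    rw [← cancel_epi e, hy, ← hl]
    simp
  exact mono_comp _ _

variable (C) in
/-- Atom equivalence of monoform objects. -/
instance atomSetoid : Setoid {H : C // Monoform H} where
  r H K := HasCommonSubobject H.1 K.1
  iseqv :=
    { refl := fun H => ⟨H.1, 𝟙 _, 𝟙 _, inferInstance, inferInstance, H.2.1⟩
      symm := fun h => h.symm
      trans := fun {_ K _} h₁ h₂ => K.2.hasCommonSubobject_trans h₁ h₂ }

variable (C) in
/-- The atom spectrum: monoform objects modulo atom equivalence. -/
def ASpec : Type u := Quotient (atomSetoid C)

/-- The atom of a monoform object. -/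
def atom (H : C) (hH : Monoform H) : ASpec C := Quotient.mk (atomSetoid C) ⟨H, hH⟩

/-- The atom support of an object. -/
def ASupp (M : C) : Set (ASpec C) :=
  {α | ∃ (H : C) (hH : Monoform H), atom H hH = α ∧ IsSubquotient H M}

theorem ASupp_mono {Z M : C} (z : Z ⟶ M) [Mono z] : ASupp Z ⊆ ASupp M := by
  rintro α ⟨H, hH, rfl, L, i, p, hi, hp⟩
  exact ⟨H, hH, rfl, L, i ≫ z, p, mono_comp _ _, hp⟩

/-- A set `Φ` of atoms is open if every `α ∈ Φ` is the atom of some monoform `H` with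
`ASupp H ⊆ Φ`. -/
instance : TopologicalSpace (ASpec C) where
  IsOpen Φ := ∀ α ∈ Φ, ∃ (H : C) (hH : Monoform H), atom H hH = α ∧ ASupp H ⊆ Φ
  isOpen_univ := by
    rintro ⟨H, hH⟩ -
    exact ⟨H, hH, rfl, Set.subset_univ _⟩
  isOpen_inter := by
    rintro Φ Ψ hΦ hΨ α ⟨h₁, h₂⟩
    obtain ⟨H, hH, rfl, hs⟩ := hΦ α h₁
    obtain ⟨K, hK, e, ht⟩ := hΨ _ h₂
    obtain ⟨Z, i, j, hi, hj, hZ⟩ := (Quotient.exact e : HasCommonSubobject K H)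
    have hZm := hH.of_mono j hZ
    refine ⟨Z, hZm, Quotient.sound ?_, ?_⟩
    · exact ⟨Z, 𝟙 Z, j, inferInstance, hj, hZ⟩
    · exact Set.subset_inter ((ASupp_mono j).trans hs) ((ASupp_mono i).trans ht)
  isOpen_sUnion := by
    rintro S hS α ⟨Φ, hΦ, hα⟩
    obtain ⟨H, hH, e, hs⟩ := hS Φ hΦ α hα
    exact ⟨H, hH, e, hs.trans (Set.subset_sUnion_of_mem hΦ)⟩

/-- The specialization order: `α ≤ β` if every open set containing `α` contains `β`. -/
instance : Preorder (ASpec C) where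
  le α β := ∀ Φ : Set (ASpec C), IsOpen Φ → α ∈ Φ → β ∈ Φ
  le_refl _ _ _ h := h
  le_trans _ _ _ h₁ h₂ Φ hΦ h := h₂ Φ hΦ (h₁ Φ hΦ h)

end Atoms

section Gabriel

variable {C : Type u} [Category.{v} C] [Abelian C]

/-- An indecomposable injective object (`Indecomposable` includes being nonzero). -/
def IndecomposableInjective (I : C) : Prop := Indecomposable I ∧ Injective I

variable (C) in
/-- Isomorphism of indecomposable injective objects. -/
instance injSetoid : Setoid {I : C // IndecomposableInjective I} where
  r I J := Nonempty (I.1 ≅ J.1)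
  iseqv :=
    { refl := fun _ => ⟨Iso.refl _⟩
      symm := fun ⟨e⟩ => ⟨e.symm⟩
      trans := fun ⟨e⟩ ⟨e'⟩ => ⟨e ≪≫ e'⟩ }

variable (C) in
/-- The Gabriel spectrum: isomorphism classes of indecomposable injective objects. -/
def Sp : Type u := Quotient (injSetoid C)

/-- The isomorphism class of an indecomposable injective object. -/
def isoClass (I : C) (hI : IndecomposableInjective I) : Sp C :=
  Quotient.mk (injSetoid C) ⟨I, hI⟩

/-- A Serre subcategory `P` is localizing if the canonical functor to the quotient category `C / P`
(the localization of `C` at the morphisms whose kernel and cokernel belong to `P`) has a right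
adjoint. -/
def IsLocalizing (P : ObjectProperty C) : Prop :=
  ∃ _ : P.IsSerreClass, P.isoModSerre.Q.IsLeftAdjoint

/-- For a localizing subcategory `P`, the set of classes of indecomposable injectives `I` with
`Hom(P, I) ≠ 0`, i.e. the classes of the injective envelopes in `C` of the indecomposable
injective objects of `P`; its complement consists of the classes of the indecomposable injectives
in `Pᗮ`. -/
def spSet (P : ObjectProperty C) : Set (Sp C) :=
  {x | ∃ (I : C) (hI : IndecomposableInjective I), isoClass I hI = x ∧
    ∃ (M : C) (g : M ⟶ I), P M ∧ g ≠ 0}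

/-- The topology with the sets `spSet P`, for `P` localizing, as basic open sets. (These sets cover,
and they are closed under finite intersections since indecomposable injectives are uniform.) -/
instance : TopologicalSpace (Sp C) :=
  TopologicalSpace.generateFrom {U | ∃ P : ObjectProperty C, IsLocalizing P ∧ U = spSet P}

/-- The subcategory `𝒳_I` of the objects `M` with `Hom(M, I) = 0`. -/
def leftPerp (I : C) : ObjectProperty C := fun M => ∀ g : M ⟶ I, g = 0

/-- The relation `Hom(𝒳_I, J) = 0`. -/
def HomPerpZero (J I : C) : Prop := ∀ M : C, leftPerp I M → ∀ g : M ⟶ J, g = 0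

theorem HomPerpZero.of_iso {J J' I I' : C} (e : J ≅ J') (f : I ≅ I') (h : HomPerpZero J I) :
    HomPerpZero J' I' := by
  intro M hM g
  have h₁ : leftPerp I M := fun k => by
    rw [← cancel_mono f.hom, zero_comp]; exact hM _
  rw [← cancel_mono e.inv, zero_comp]
  exact h M h₁ _

/-- The specialization preorder: `J ≤ I` if `Hom(𝒳_I, J) = 0`. -/
instance : Preorder (Sp C) where
  le := Quotient.lift₂ (fun J I => HomPerpZero J.1 I.1) (by
    rintro J I J' I' ⟨e⟩ ⟨f⟩
    exact propext ⟨fun h => h.of_iso e f, fun h => h.of_iso e.symm f.symm⟩)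
  le_refl := by
    rintro ⟨I⟩ M hM g
    exact hM g
  le_trans := by
    rintro ⟨K⟩ ⟨J⟩ ⟨I⟩ h₁ h₂ M hM g
    exact h₁ M (fun k => h₂ M hM k) g

/-- `i : M ⟶ I` is an injective envelope: `I` is injective and `i` is an essential monomorphism,
i.e. every nonzero subobject of `I` has nonzero intersection with `M`. -/
def IsInjectiveEnvelope {M I : C} (i : M ⟶ I) : Prop :=
  Injective I ∧ Mono i ∧ ∀ (Z : C) (j : Z ⟶ I), Mono j → ¬ IsZero Z → ¬ IsZero (pullback i j)

end Gabriel

end AtomSpectrum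

/-! Everything rests on one criterion (`IsInjectiveEnvelope.atom_mem_ASupp_iff`): for `H` monoform
with envelope `I`, the atom of `H` lies in `ASupp M` iff `Hom(M, I) ≠ 0`. Both preorders compare
which objects `M` a point detects, through supports on one side and nonzero morphisms on the other,
so `f` preserves and reflects order; basic open sets pull back to unions of supports, which are
open. Monoform objects are uniform, and so are their envelopes: this gives indecomposability, and
injectivity of `f`, since two monoform subobjects of one envelope meet. Antisymmetry on atoms
(`atom_eq_of_mem_ASupp`) holds because a monoform object shares no nonzero subobject with its proper
quotients; surjectivity carries it to `Sp`. -/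

namespace AtomSpectrum

/-! ### Existence of injective envelopes, by complements and Zorn's lemma. -/

section InjectiveEnvelopes

variable {C : Type u} [Category.{v} C] [Abelian C]

/-- If `a` meets `b` trivially, then `b` meets `a` trivially. -/
theorem mono_comp_cokernel_symm {A B Q : C} (a : A ⟶ Q) (b : B ⟶ Q) [Mono a] [Mono b]
    (h : Mono (a ≫ cokernel.π b)) : Mono (b ≫ cokernel.π a) := by
  refine Preadditive.mono_of_cancel_zero _ fun {T} x hx => ?_
  have hl := Abelian.monoLift_comp a (x ≫ b) (by simpa using hx)
  have h0 : Abelian.monoLift a (x ≫ b) (by simpa using hx) = 0 := by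
    rw [← cancel_mono (a ≫ cokernel.π b), ← Category.assoc, hl]
    simp
  rw [← cancel_mono b, ← hl, h0, zero_comp, zero_comp]

/-- `i` is a monomorphism such that any morphism with monic restriction along `i` is monic. -/
def IsEssentialMono {M I : C} (i : M ⟶ I) : Prop :=
  Mono i ∧ ∀ {Y : C} (g : I ⟶ Y), Mono (i ≫ g) → Mono g

theorem IsEssentialMono.isZero_of_isZero_pullback {M I : C} {i : M ⟶ I} (hi : IsEssentialMono i)
    {Z : C} (j : Z ⟶ I) [Mono j] (h : IsZero (pullback i j)) : IsZero Z := by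
  have hm : Mono (i ≫ cokernel.π j) := by
    refine Preadditive.mono_of_cancel_zero _ fun {T} x hx => ?_
    have hl := Abelian.monoLift_comp j (x ≫ i) (by simpa using hx)
    rw [← pullback.lift_fst x _ hl.symm, h.eq_of_src (pullback.fst i j) 0, comp_zero]
  have := hi.2 _ hm
  have hj : j = 0 := by
    rw [← cancel_mono (cokernel.π j)]
    simp
  exact (IsZero.iff_id_eq_zero Z).2 (by rw [← cancel_mono j, hj, comp_zero, comp_zero])

theorem IsEssentialMono.isInjectiveEnvelope {M I : C} [Injective I] {i : M ⟶ I}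
    (hi : IsEssentialMono i) : IsInjectiveEnvelope i :=
  ⟨inferInstance, hi.1, fun _ j _ hZ h => hZ (hi.isZero_of_isZero_pullback j h)⟩

/-- The union of a directed family of subobjects meeting `m` trivially meets `m` trivially. -/
theorem exists_upperBound_of_monotone [IsGrothendieckAbelian.{w} C] {M Q : C} (m : M ⟶ Q)
    {J : Type w} [Preorder J] [IsDirectedOrder J] [Nonempty J] (s : J → Subobject Q)
    (hs : Monotone s) (hm : ∀ j, Mono ((s j).arrow ≫ cokernel.π m)) :
    ∃ U : Subobject Q, Mono (U.arrow ≫ cokernel.π m) ∧ ∀ j, s j ≤ U := by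
  have : IsConnected J := IsFiltered.isConnected J
  let G : J ⥤ C :=
    { obj := fun j => (s j : C)
      map := fun {i j} h => Subobject.ofLE (s i) (s j) (hs (leOfHom h))
      map_id := fun _ => Subobject.ofLE_refl _
      map_comp := fun _ _ => (Subobject.ofLE_comp_ofLE _ _ _ _ _).symm }
  let φ : G ⟶ (Functor.const J).obj (cokernel m) :=
    { app := fun j => (s j).arrow ≫ cokernel.π m
      naturality := fun i j k => by simp [G] }
  have : ∀ j, Mono (φ.app j) := fun j => hm j
  have : Mono φ := NatTrans.mono_of_mono_app φ
  let d : Cocone G :=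
    { pt := Q
      ι :=
        { app := fun j => (s j).arrow
          naturality := fun i j k => by simp [G] } }
  let f : colimit G ⟶ Q := colimit.desc G d
  have hf : ∀ j, colimit.ι G j ≫ f = (s j).arrow := fun j => colimit.ι_desc d j
  -- AB5: a filtered colimit of the monomorphisms `s j ⟶ Q / M` is monic.
  have hmono : Mono (f ≫ cokernel.π m) :=
    colim.map_mono' φ (colimit.isColimit G) (isColimitConstCocone J (cokernel m)) _ fun j =>
      (Category.assoc _ _ _).symm.trans
        ((congrArg (· ≫ cokernel.π m) (hf j)).trans (Category.comp_id _).symm)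
  have : Mono f := mono_of_mono f (cokernel.π m)
  refine ⟨Subobject.mk f, ?_, fun j => ?_⟩
  · rw [← Subobject.underlyingIso_hom_comp_eq_mk, Category.assoc]
    infer_instance
  · exact Subobject.le_mk_of_comm (colimit.ι G j) (hf j)

/-- A chain of subobjects meeting `m` trivially is bounded by a subobject meeting `m` trivially. -/
theorem exists_upperBound_of_isChain [IsGrothendieckAbelian.{w} C] {M Q : C} (m : M ⟶ Q)
    (c : Set (Subobject Q)) (hc : ∀ K ∈ c, Mono (K.arrow ≫ cokernel.π m))
    (hchain : IsChain (· ≤ ·) c) (hne : c.Nonempty) :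
    ∃ U : Subobject Q, Mono (U.arrow ≫ cokernel.π m) ∧ ∀ K ∈ c, K ≤ U := by
  let s : Shrink.{w} c → Subobject Q := fun j => ((equivShrink c).symm j).1
  let _ : Preorder (Shrink.{w} c) := Preorder.lift s
  have : Nonempty (Shrink.{w} c) := hne.to_subtype.map (equivShrink c)
  have : IsDirectedOrder (Shrink.{w} c) := ⟨fun a b => by
    rcases hchain.total ((equivShrink c).symm a).2 ((equivShrink c).symm b).2 with h | h
    · exact ⟨b, h, le_refl _⟩
    · exact ⟨a, le_refl _, h⟩⟩
  obtain ⟨U, hU, hle⟩ := exists_upperBound_of_monotone.{w} m s (fun _ _ h => h)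
    fun j => hc _ ((equivShrink c).symm j).2
  exact ⟨U, hU, fun K hK => by simpa [s] using hle (equivShrink c ⟨K, hK⟩)⟩

/-- Every subobject has a complement, maximal among the subobjects meeting it trivially. -/
theorem exists_complement [IsGrothendieckAbelian.{w} C] {M Q : C} (m : M ⟶ Q) [Mono m] :
    ∃ (K : C) (k : K ⟶ Q), Mono k ∧ Mono (m ≫ cokernel.π k) ∧
      ∀ (K' : C) (k' : K' ⟶ Q) (t : K ⟶ K'), Mono k' → t ≫ k' = k →
        Mono (m ≫ cokernel.π k') → ∃ s, s ≫ k = k' := by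
  obtain ⟨U, -, hU, hmax⟩ := zorn_le_nonempty₀
    {K : Subobject Q | Mono (K.arrow ≫ cokernel.π m)}
    (fun c hc hchain y hy => exists_upperBound_of_isChain m c hc hchain ⟨y, hy⟩) ⊥ (by
      refine Preadditive.mono_of_cancel_zero _ fun x _ => ?_
      rw [← cancel_mono (⊥ : Subobject Q).arrow]
      simp)
  refine ⟨_, U.arrow, inferInstance, mono_comp_cokernel_symm _ _ hU, fun K' k' t _ ht hK' => ?_⟩
  have hle : U ≤ Subobject.mk k' := Subobject.le_mk_of_comm t ht
  have hmk : Subobject.mk k' ∈ {K : Subobject Q | Mono (K.arrow ≫ cokernel.π m)} := by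
    have := mono_comp_cokernel_symm _ _ hK'
    change Mono _
    rw [← Subobject.underlyingIso_hom_comp_eq_mk, Category.assoc]
    infer_instance
  exact ⟨Subobject.ofMkLE k' U (hmax hmk hle), Subobject.ofMkLE_arrow _⟩

/-- A subobject is essential modulo a complement. -/
theorem isEssentialMono_of_complement {M Q K : C} (m : M ⟶ Q) (k : K ⟶ Q) [Mono k]
    (hk : Mono (m ≫ cokernel.π k))
    (hmax : ∀ (K' : C) (k' : K' ⟶ Q) (t : K ⟶ K'), Mono k' → t ≫ k' = k →
      Mono (m ≫ cokernel.π k') → ∃ s, s ≫ k = k') :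
    IsEssentialMono (m ≫ cokernel.π k) := by
  refine ⟨hk, fun {Y} g hg => ?_⟩
  -- The preimage in `Q` of `ker g` contains `K` and still meets `M` trivially, so maximality puts
  -- it inside `K`, and `ker g = 0`.
  let k' := kernel.ι (cokernel.π k ≫ g)
  have hm : Mono (m ≫ cokernel.π k') := by
    have : Mono ((m ≫ cokernel.π k') ≫
        cokernel.desc k' (cokernel.π k ≫ g) (kernel.condition _)) := by
      simpa using hg
    exact mono_of_mono _ (cokernel.desc k' (cokernel.π k ≫ g) (kernel.condition _))
  obtain ⟨s, hs⟩ := hmax _ k' (kernel.lift _ k (by simp)) inferInstance (kernel.lift_ι _ _ _) hm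
  refine Preadditive.mono_of_cancel_zero _ fun {T} x hx => ?_
  obtain ⟨T', e, he, y, hy⟩ := surjective_up_to_refinements_of_epi (cokernel.π k) x
  have h0 : y ≫ cokernel.π k ≫ g = 0 := by
    rw [← Category.assoc, ← hy, Category.assoc, hx, comp_zero]
  rw [← cancel_epi e, hy, comp_zero, ← kernel.lift_ι _ y h0]
  change (_ ≫ k') ≫ _ = 0
  rw [← hs]
  simp

/-- For `M` inside an injective `Q` with complement `K`, the envelope is `Q / K`. It is injective
because `K` is a direct summand of `Q`, as a complement `L` of `K` shows. -/
theorem exists_isInjectiveEnvelope [IsGrothendieckAbelian.{w} C] (M : C) :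
    ∃ (I : C) (i : M ⟶ I), IsInjectiveEnvelope i := by
  let Q := Injective.under M
  let m : M ⟶ Q := Injective.ι M
  obtain ⟨K, k, hk, hmk, hmax⟩ := exists_complement.{w} m
  obtain ⟨L, l, hl, hkl, hmax'⟩ := exists_complement.{w} k
  have hess := isEssentialMono_of_complement k l hkl hmax'
  -- `K` is essential in `Q / L`, so the extension `r` of `k` is monic and its image meets `M`
  -- trivially. Maximality of `K` puts that image inside `K`, whence a retraction `Q ⟶ Q / L ⟶ K`.
  let r : cokernel l ⟶ Q := Injective.factorThru k (k ≫ cokernel.π l)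
  have hr : (k ≫ cokernel.π l) ≫ r = k := Injective.comp_factorThru _ _
  have : Mono r := hess.2 r (by rwa [hr])
  have hrm : Mono (r ≫ cokernel.π m) := hess.2 _ (by
    rw [← Category.assoc, hr]
    exact mono_comp_cokernel_symm _ _ hmk)
  obtain ⟨s, hs⟩ := hmax _ r (k ≫ cokernel.π l) this hr (mono_comp_cokernel_symm _ _ hrm)
  have hsplit : k ≫ cokernel.π l ≫ s = 𝟙 K := by
    rw [← cancel_mono k]
    simpa [hs] using hr
  let σ : cokernel k ⟶ Q := cokernel.desc k (𝟙 Q - (cokernel.π l ≫ s) ≫ k) (by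
    rw [Preadditive.comp_sub, ← Category.assoc, hsplit]
    simp)
  have hσ : σ ≫ cokernel.π k = 𝟙 _ := by
    rw [← cancel_epi (cokernel.π k)]
    simp [σ]
  have : Injective (cokernel k) := (Retract.mk σ (cokernel.π k) hσ).injective
  exact ⟨_, _, (isEssentialMono_of_complement m k hmk hmax).isInjectiveEnvelope⟩

end InjectiveEnvelopes

/-! ### Atom supports and antisymmetry of the order on atoms. -/

section AtomSupport

variable {C : Type u} [Category.{v} C] [Abelian C]

theorem not_isZero_of_epi {X Y : C} (p : X ⟶ Y) [Epi p] (hY : ¬ IsZero Y) : ¬ IsZero X :=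
  fun h => hY (IsZero.of_epi p h)

theorem not_isZero_of_mono {X Y : C} (p : X ⟶ Y) [Mono p] (hX : ¬ IsZero X) : ¬ IsZero Y :=
  fun h => hX (IsZero.of_mono p h)

theorem atom_eq_atom_iff {H K : C} {hH : Monoform H} {hK : Monoform K} :
    atom H hH = atom K hK ↔ HasCommonSubobject H K :=
  ⟨fun h => Quotient.exact h, fun h => Quotient.sound h⟩

theorem exists_eq_atom (α : ASpec C) : ∃ (H : C) (hH : Monoform H), α = atom H hH := by
  obtain ⟨⟨H, hH⟩, rfl⟩ := Quotient.exists_rep α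
  exact ⟨H, hH, rfl⟩

theorem IsSubquotient.trans {X Y Z : C} (h₁ : IsSubquotient X Y) (h₂ : IsSubquotient Y Z) :
    IsSubquotient X Z := by
  obtain ⟨L, i, p, hi, hp⟩ := h₁
  obtain ⟨L', i', p', hi', hp'⟩ := h₂
  exact ⟨pullback p' i, pullback.fst p' i ≫ i', pullback.snd p' i ≫ p, mono_comp _ _,
    epi_comp _ _⟩

theorem ASupp_subset_of_isSubquotient {X Y : C} (h : IsSubquotient X Y) : ASupp X ⊆ ASupp Y := by
  rintro α ⟨H, hH, rfl, hs⟩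
  exact ⟨H, hH, rfl, hs.trans h⟩

theorem atom_mem_ASupp {H : C} (hH : Monoform H) : atom H hH ∈ ASupp H :=
  ⟨H, hH, rfl, H, 𝟙 H, 𝟙 H, inferInstance, inferInstance⟩

theorem isOpen_ASupp (M : C) : IsOpen (ASupp M) := by
  rintro α ⟨H, hH, rfl, hs⟩
  exact ⟨H, hH, rfl, ASupp_subset_of_isSubquotient hs⟩

/-- The supports of objects form a basis of the topology on atoms. -/
theorem le_iff_forall_mem_ASupp {α β : ASpec C} :
    α ≤ β ↔ ∀ M : C, α ∈ ASupp M → β ∈ ASupp M := by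
  refine ⟨fun h M hM => h _ (isOpen_ASupp M) hM, fun h Φ hΦ hα => ?_⟩
  obtain ⟨H, hH, rfl, hs⟩ := hΦ α hα
  exact hs (h H (atom_mem_ASupp hH))

/-- An atom in the support of a monoform object `H`, all of whose representatives have the atom of
`H` in their support, is the atom of `H`. -/
theorem atom_eq_of_mem_ASupp {H : C} (hH : Monoform H) {β : ASpec C} (h₁ : β ∈ ASupp H)
    (h₂ : ∀ (K : C) (hK : Monoform K), atom K hK = β → atom H hH ∈ ASupp K) :
    atom H hH = β := by
  obtain ⟨K, hK, rfl, L, l, p, hl, hp⟩ := h₁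
  by_cases h0 : IsZero (kernel p)
  · have : Mono p := Preadditive.mono_of_kernel_zero (h0.eq_of_src _ _)
    have := isIso_of_mono_of_epi p
    exact atom_eq_atom_iff.2 ⟨K, inv p ≫ l, 𝟙 K, mono_comp _ _, inferInstance, hK.1⟩
  · exfalso
    -- The preimage of `N ⊆ K` in `L` is a subobject of `H` mapping onto `H'` with kernel containing
    -- `ker p ≠ 0`. As `H'` has the atom of `H`, this monoform preimage shares a nonzero subobject
    -- with a proper quotient of itself.
    obtain ⟨H', hH', e, N, n, q, hn, hq⟩ := h₂ K hK rfl
    let r : pullback p n ⟶ H' := pullback.snd p n ≫ q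
    have hr : Epi r := epi_comp _ _
    have hP : ¬ IsZero (pullback p n) := not_isZero_of_epi r hH'.1
    have hPm : Monoform (pullback p n) := hH.of_mono (pullback.fst p n ≫ l) hP
    have hker : ¬ IsZero (kernel r) := by
      let a : kernel p ⟶ pullback p n := pullback.lift (kernel.ι p) 0 (by simp)
      have ha : a ≫ pullback.fst p n = kernel.ι p := pullback.lift_fst _ _ _
      have har : a ≫ r = 0 := by
        rw [← Category.assoc, pullback.lift_snd, zero_comp]
      have : Mono (kernel.lift r a har) := by
        have : Mono (kernel.lift r a har ≫ kernel.ι r ≫ pullback.fst p n) := by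
          rw [kernel.lift_ι_assoc, ha]
          infer_instance
        exact mono_of_mono _ (kernel.ι r ≫ pullback.fst p n)
      exact not_isZero_of_mono (kernel.lift r a har) h0
    have hcom : HasCommonSubobject (pullback p n) H' := by
      refine hH.hasCommonSubobject_trans
        ⟨_, 𝟙 _, pullback.fst p n ≫ l, inferInstance, mono_comp _ _, hP⟩ (atom_eq_atom_iff.1 e.symm)
    obtain ⟨Z, z, z', hz, hz', hZ⟩ := hcom
    let t : H' ⟶ cokernel (kernel.ι r) := Abelian.epiDesc r (cokernel.π _) (by simp)
    have ht : t ≫ cokernel.desc (kernel.ι r) r (kernel.condition r) = 𝟙 H' := by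
      rw [← cancel_epi r]
      simp [t, Abelian.comp_epiDesc_assoc]
    have : IsSplitMono t := .mk' ⟨_, ht⟩
    exact hPm.2 _ (kernel.ι r) inferInstance hker ⟨Z, z, z' ≫ t, hz, mono_comp _ _, hZ⟩

theorem ASpec_le_antisymm {α β : ASpec C} (h₁ : α ≤ β) (h₂ : β ≤ α) : α = β := by
  obtain ⟨H, hH, rfl⟩ := exists_eq_atom α
  refine atom_eq_of_mem_ASupp hH (le_iff_forall_mem_ASupp.1 h₁ H (atom_mem_ASupp hH)) ?_
  rintro K hK rfl
  exact le_iff_forall_mem_ASupp.1 h₂ K (atom_mem_ASupp hK)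

end AtomSupport

/-! ### Envelopes of monoform objects and the support criterion. -/

section Envelopes

variable {C : Type u} [Category.{v} C] [Abelian C]

/-- Two nonzero subobjects of an injective envelope of a monoform object meet in a nonzero
object. -/
theorem IsInjectiveEnvelope.exists_meet {H I : C} {i : H ⟶ I} (h : IsInjectiveEnvelope i)
    (hH : Monoform H) {A B : C} (a : A ⟶ I) (b : B ⟶ I) [Mono a] [Mono b]
    (hA : ¬ IsZero A) (hB : ¬ IsZero B) :
    ∃ (W : C) (p : W ⟶ A) (q : W ⟶ B), Mono p ∧ Mono q ∧ ¬ IsZero W ∧ p ≫ a = q ≫ b := by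
  have := h.2.1
  obtain ⟨W, p, q, hp, hq, hW, e⟩ := hH.exists_meet (pullback.fst i a) (pullback.fst i b)
    (h.2.2 A a inferInstance hA) (h.2.2 B b inferInstance hB)
  refine ⟨W, p ≫ pullback.snd i a, q ≫ pullback.snd i b, mono_comp _ _, mono_comp _ _, hW, ?_⟩
  rw [Category.assoc, Category.assoc, ← pullback.condition, ← pullback.condition,
    reassoc_of% e]

/-- A morphism out of an envelope of a monoform object is monic if it is monic on some nonzero
subobject. -/
theorem IsInjectiveEnvelope.mono_of_mono_comp {H I : C} {i : H ⟶ I} (h : IsInjectiveEnvelope i)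
    (hH : Monoform H) {Z Y : C} (z : Z ⟶ I) [Mono z] (hZ : ¬ IsZero Z) (g : I ⟶ Y)
    (hg : Mono (z ≫ g)) : Mono g := by
  by_contra hm
  have h0 : ¬ IsZero (kernel g) := fun h0 =>
    hm (Preadditive.mono_of_kernel_zero (h0.eq_of_src _ _))
  obtain ⟨W, p, q, hp, hq, hW, e⟩ := h.exists_meet hH z (kernel.ι g) hZ h0
  refine hW ((IsZero.iff_id_eq_zero W).2 ?_)
  have : p = 0 := by
    rw [← cancel_mono (z ≫ g), reassoc_of% e]
    simp
  rw [← cancel_mono p, this, comp_zero, comp_zero]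

theorem IsInjectiveEnvelope.indecomposableInjective {H I : C} {i : H ⟶ I}
    (h : IsInjectiveEnvelope i) (hH : Monoform H) : IndecomposableInjective I := by
  have := h.2.1
  refine ⟨⟨not_isZero_of_mono i hH.1, fun Y Z e => ?_⟩, h.1⟩
  by_contra! hYZ
  obtain ⟨W, p, q, hp, hq, hW, hpq⟩ := h.exists_meet hH (biprod.inl ≫ e.inv) (biprod.inr ≫ e.inv)
    hYZ.1 hYZ.2
  have hpq' := congrArg (· ≫ e.hom ≫ biprod.fst) hpq
  have hp0 : p = 0 := by simpa using hpq'
  exact hW ((IsZero.iff_id_eq_zero W).2 (by rw [← cancel_mono p, hp0, comp_zero, comp_zero]))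

/-- Injective envelopes of atom-equivalent monoform objects are isomorphic. -/
theorem IsInjectiveEnvelope.nonempty_iso {H K I J : C} {i : H ⟶ I} {j : K ⟶ J}
    (hi : IsInjectiveEnvelope i) (hj : IsInjectiveEnvelope j) (hH : Monoform H) (hK : Monoform K)
    (h : HasCommonSubobject H K) : Nonempty (I ≅ J) := by
  obtain ⟨Z, a, b, ha, hb, hZ⟩ := h
  have := hi.1
  have := hi.2.1
  have := hj.1
  have := hj.2.1
  let φ : I ⟶ J := Injective.factorThru (b ≫ j) (a ≫ i)
  have hφ : (a ≫ i) ≫ φ = b ≫ j := Injective.comp_factorThru _ _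
  have : Mono φ := hi.mono_of_mono_comp hH (a ≫ i) hZ φ (by rw [hφ]; infer_instance)
  let ψ : J ⟶ I := Injective.factorThru (𝟙 I) φ
  have hψ : φ ≫ ψ = 𝟙 I := Injective.comp_factorThru _ _
  -- `ψ` is split epi, and monic because it is monic on the nonzero subobject `φ` of `J`; hence it
  -- is invertible.
  have : Mono ψ := hj.mono_of_mono_comp hK φ
    (hi.indecomposableInjective hH).1.1 ψ (by rw [hψ]; infer_instance)
  exact ⟨⟨φ, ψ, hψ, by rw [← cancel_mono ψ, Category.assoc, hψ, Category.comp_id,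
    Category.id_comp]⟩⟩

/-- Monoform objects with a common injective envelope are atom-equivalent. -/
theorem IsInjectiveEnvelope.hasCommonSubobject {H K I J : C} {i : H ⟶ I} {j : K ⟶ J}
    (hi : IsInjectiveEnvelope i) (hj : IsInjectiveEnvelope j) (hH : Monoform H) (hK : Monoform K)
    (e : I ≅ J) : HasCommonSubobject H K := by
  have := hi.2.1
  have := hj.2.1
  obtain ⟨W, p, q, hp, hq, hW, -⟩ := hi.exists_meet hH i (j ≫ e.inv) hH.1 hK.1
  exact ⟨W, p, q, hp, hq, hW⟩

/-- A monoform object has its atom in the support of `M` if and only if there is a nonzero morphism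
from `M` to its injective envelope. -/
theorem IsInjectiveEnvelope.atom_mem_ASupp_iff {H I : C} {i : H ⟶ I} (h : IsInjectiveEnvelope i)
    (hH : Monoform H) (M : C) : atom H hH ∈ ASupp M ↔ ∃ g : M ⟶ I, g ≠ 0 := by
  have := h.1
  have := h.2.1
  constructor
  · rintro ⟨K, hK, e, L, l, p, hl, hp⟩
    obtain ⟨Z, a, b, ha, hb, hZ⟩ := atom_eq_atom_iff.1 e
    -- Extend `Z ⟶ I` to `K`, pull back to `L`, extend to `M`; the result is nonzero because `Z ⟶ I`
    -- is.
    let φ : K ⟶ I := Injective.factorThru (b ≫ i) a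
    have hφ : a ≫ φ = b ≫ i := Injective.comp_factorThru _ _
    refine ⟨Injective.factorThru (p ≫ φ) l, fun h0 => hZ ?_⟩
    have h1 : p ≫ φ = 0 := by rw [← Injective.comp_factorThru (p ≫ φ) l, h0, comp_zero]
    have h2 : φ = 0 := by rw [← cancel_epi p, h1, comp_zero]
    rw [h2, comp_zero] at hφ
    rw [IsZero.iff_id_eq_zero, ← cancel_mono (b ≫ i), ← hφ, comp_zero, comp_zero]
  · rintro ⟨g, hg⟩
    -- By essentiality the image of `g` meets `H`; the intersection represents the atom of `H` and
    -- is a subquotient of `M`.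
    have hP : ¬ IsZero (pullback i (image.ι g)) := h.2.2 _ _ inferInstance fun h0 => hg (by
      rw [← image.fac g, h0.eq_of_src (image.ι g) 0, comp_zero])
    have hPm := hH.of_mono (pullback.fst i (image.ι g)) hP
    refine ⟨_, hPm, atom_eq_atom_iff.2 ⟨_, 𝟙 _, pullback.fst i (image.ι g), inferInstance,
      inferInstance, hP⟩, pullback (factorThruImage g) (pullback.snd i (image.ι g)),
      pullback.fst _ _, pullback.snd _ _, inferInstance, inferInstance⟩

end Envelopes

/-! ### The map from atoms to indecomposable injectives. -/

section AtomsToInjectives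

variable {C : Type u} [Category.{v} C] [Abelian C]

theorem isoClass_eq_isoClass_iff {I J : C} {hI : IndecomposableInjective I}
    {hJ : IndecomposableInjective J} : isoClass I hI = isoClass J hJ ↔ Nonempty (I ≅ J) :=
  ⟨fun h => Quotient.exact h, fun h => Quotient.sound h⟩

theorem isoClass_mem_spSet_iff {P : ObjectProperty C} {I : C} {hI : IndecomposableInjective I} :
    isoClass I hI ∈ spSet P ↔ ∃ M, P M ∧ ∃ g : M ⟶ I, g ≠ 0 := by
  constructor
  · rintro ⟨J, hJ, e, M, g, hM, hg⟩
    obtain ⟨e⟩ := isoClass_eq_isoClass_iff.1 e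
    refine ⟨M, hM, g ≫ e.hom, fun h0 => hg ?_⟩
    rw [← cancel_mono e.hom, h0, zero_comp]
  · rintro ⟨M, hM, g, hg⟩
    exact ⟨I, hI, rfl, M, g, hM, hg⟩

theorem isoClass_le_isoClass_iff {I J : C} {hI : IndecomposableInjective I}
    {hJ : IndecomposableInjective J} :
    isoClass J hJ ≤ isoClass I hI ↔
      ∀ M : C, (∃ g : M ⟶ J, g ≠ 0) → ∃ g : M ⟶ I, g ≠ 0 := by
  change HomPerpZero J I ↔ _
  refine forall_congr' fun M => ?_
  rw [← not_imp_not]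
  simp [leftPerp]

variable [IsGrothendieckAbelian.{w} C]

/-- The map sending the atom of a monoform object to the class of its injective envelope. -/
noncomputable def injectiveEnvelopeClass : ASpec C → Sp C :=
  Quotient.lift
    (fun H => isoClass _ ((exists_isInjectiveEnvelope.{w} H.1).choose_spec.choose_spec
      |>.indecomposableInjective H.2))
    fun H K h => isoClass_eq_isoClass_iff.2
      ((exists_isInjectiveEnvelope.{w} H.1).choose_spec.choose_spec.nonempty_iso
        (exists_isInjectiveEnvelope.{w} K.1).choose_spec.choose_spec H.2 K.2 h)

theorem injectiveEnvelopeClass_atom {H I : C} (hH : Monoform H) {i : H ⟶ I}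
    (h : IsInjectiveEnvelope i) :
    injectiveEnvelopeClass.{w} (atom H hH) = isoClass I (h.indecomposableInjective hH) :=
  isoClass_eq_isoClass_iff.2
    ((exists_isInjectiveEnvelope.{w} H).choose_spec.choose_spec.nonempty_iso h hH hH
      ⟨H, 𝟙 H, 𝟙 H, inferInstance, inferInstance, hH.1⟩)

theorem injectiveEnvelopeClass_le_iff {α β : ASpec C} :
    injectiveEnvelopeClass.{w} α ≤ injectiveEnvelopeClass.{w} β ↔ α ≤ β := by
  obtain ⟨H, hH, rfl⟩ := exists_eq_atom α
  obtain ⟨K, hK, rfl⟩ := exists_eq_atom β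
  obtain ⟨I, i, hi⟩ := exists_isInjectiveEnvelope.{w} H
  obtain ⟨J, j, hj⟩ := exists_isInjectiveEnvelope.{w} K
  rw [injectiveEnvelopeClass_atom hH hi, injectiveEnvelopeClass_atom hK hj,
    isoClass_le_isoClass_iff, le_iff_forall_mem_ASupp]
  simp only [hi.atom_mem_ASupp_iff hH, hj.atom_mem_ASupp_iff hK]

theorem injectiveEnvelopeClass_injective :
    Function.Injective (injectiveEnvelopeClass.{w} : ASpec C → Sp C) := by
  intro α β h
  obtain ⟨H, hH, rfl⟩ := exists_eq_atom α
  obtain ⟨K, hK, rfl⟩ := exists_eq_atom β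
  obtain ⟨I, i, hi⟩ := exists_isInjectiveEnvelope.{w} H
  obtain ⟨J, j, hj⟩ := exists_isInjectiveEnvelope.{w} K
  rw [injectiveEnvelopeClass_atom hH hi, injectiveEnvelopeClass_atom hK hj] at h
  obtain ⟨e⟩ := isoClass_eq_isoClass_iff.1 h
  exact atom_eq_atom_iff.2 (hi.hasCommonSubobject hj hH hK e)

theorem injectiveEnvelopeClass_preimage_spSet (P : ObjectProperty C) :
    (injectiveEnvelopeClass.{w} : ASpec C → Sp C) ⁻¹' spSet P = ⋃ (M : C) (_ : P M), ASupp M := by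
  ext α
  obtain ⟨H, hH, rfl⟩ := exists_eq_atom α
  obtain ⟨I, i, hi⟩ := exists_isInjectiveEnvelope.{w} H
  rw [Set.mem_preimage, injectiveEnvelopeClass_atom hH hi, isoClass_mem_spSet_iff]
  simp [hi.atom_mem_ASupp_iff hH]

theorem continuous_injectiveEnvelopeClass :
    Continuous (injectiveEnvelopeClass.{w} : ASpec C → Sp C) := by
  refine continuous_generateFrom_iff.2 ?_
  rintro _ ⟨P, -, rfl⟩
  rw [injectiveEnvelopeClass_preimage_spSet]
  exact isOpen_iUnion fun M => isOpen_iUnion fun _ => isOpen_ASupp M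

end AtomsToInjectives

end AtomSpectrum

theorem mainTheorem8 {C : Type u} [CategoryTheory.Category.{v} C] [CategoryTheory.Abelian C]
    [CategoryTheory.IsGrothendieckAbelian.{w} C] :
    ∃ f : AtomSpectrum.ASpec C → AtomSpectrum.Sp C,
      (∀ (H : C) (hH : AtomSpectrum.Monoform H),
        (∃ (I : C) (i : H ⟶ I), AtomSpectrum.IsInjectiveEnvelope i) ∧
        ∀ (I : C) (i : H ⟶ I), AtomSpectrum.IsInjectiveEnvelope i →
          ∃ hI : AtomSpectrum.IndecomposableInjective I,
            f (AtomSpectrum.atom H hH) = AtomSpectrum.isoClass I hI) ∧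
      Function.Injective f ∧ Monotone f ∧ Continuous f ∧
      (Function.Surjective f →
        (∀ α β : AtomSpectrum.ASpec C, α ≤ β → β ≤ α → α = β) ∧
        (∀ x y : AtomSpectrum.Sp C, x ≤ y → y ≤ x → x = y) ∧
        ∃ e : AtomSpectrum.ASpec C ≃o AtomSpectrum.Sp C, ∀ α, e α = f α) := by
  refine ⟨AtomSpectrum.injectiveEnvelopeClass.{w}, fun H hH =>
    ⟨AtomSpectrum.exists_isInjectiveEnvelope.{w} H, fun I i hi =>
      ⟨hi.indecomposableInjective hH, AtomSpectrum.injectiveEnvelopeClass_atom hH hi⟩⟩,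
    AtomSpectrum.injectiveEnvelopeClass_injective,
    fun _ _ h => AtomSpectrum.injectiveEnvelopeClass_le_iff.2 h,
    AtomSpectrum.continuous_injectiveEnvelopeClass, fun hsurj =>
    ⟨fun _ _ => AtomSpectrum.ASpec_le_antisymm, fun x y hxy hyx => ?_,
      ⟨Equiv.ofBijective _ ⟨AtomSpectrum.injectiveEnvelopeClass_injective, hsurj⟩,
        AtomSpectrum.injectiveEnvelopeClass_le_iff⟩, fun _ => rfl⟩⟩
  -- Both points come from atoms, where antisymmetry is known, and the map reflects order.
  obtain ⟨α, rfl⟩ := hsurj x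
  obtain ⟨β, rfl⟩ := hsurj y
  rw [AtomSpectrum.ASpec_le_antisymm (AtomSpectrum.injectiveEnvelopeClass_le_iff.1 hxy)
    (AtomSpectrum.injectiveEnvelopeClass_le_iff.1 hyx)]
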